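/- **Model.** A fog system has finite sets $\mathcal N$ of edge nodes and $\mathcal M$ of central nodes and runs in slots $t=0,1,2,\dots$. Workload $A_i(t)\ge 0$ arrives at edge node $i$ in slot $t$; the $A_i(t)$ are bounded, independent over $t$ and $i$, with a law not depending on $t$, and $\mathbb E A_i(t)=\lambda_i$, $\sum_i\lambda_i>0$. The channel gains $H_{ij}(t)$ and the cloud link capacities $D_j(t)$ are nonnegative, bounded and independent of the arrivals. Every node $k\in\mathcal N\cup\mathcal M$ has backlogs $Q_k^{a},Q_k^{l},Q_k^{o}$ (integrate queue of an edge node, or arrival queue of a central node; local processing queue; offloading queue). In every slot the scheme PORA (i) grants the capacities $b_k^{\beta}=b_{k,\max}^{\beta}$ if $Q_k^{\beta}<Q_k^{a}$ and $b_k^\beta=0$ otherwise, for $\beta\in\{l,o\}$; (ii) sets the CPU frequency $f_k=\min\{\sqrt{Q_k^{l}/(3V\varsigma L_k)},f_{k,\max}\}$; (iii) lets each edge node $i$, with set $\mathcal M_i$ of accessible central nodes, choose transmit powers $p_{ij}\ge0$ $(j\in\mathcal M_i)$ with $\sum_j p_{ij}\le p_{i,\max}$ that minimize $\sum_{j\in\mathcal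 M_i}\bigl[Vp_{ij}-(Q_i^{o}-Q_j^{a})B\log_2(1+\tfrac{H_{ij}}{N_0B}p_{ij})\bigr]$, giving the link rates $R_{ij}=\tau_0B\log_2(1+\tfrac{p_{ij}H_{ij}}{N_0B})$. The local queues have service capacity $\tau_0f_k/L_k$, the offloading queues $\sum_{j\in\mathcal M_i}R_{ij}$ (edge) or $D_j$ (central), and the queues $Q_k^a$ have output capacity $b_k^l+b_k^o$. Capacities are used as far as the backlogs permit; how the moved workload is divided when there is less of it than capacity may be any fixed function of the current backlogs and the current environment $(H,D)$. With prediction windows $\boldsymbol W=(W_i)_{i\in\mathcal N}$ and perfect prediction, the integrate queue of edge node $i$ at the beginning of slot $t$ consists of its arrival queue $A_{i,-1}(t)$ (untreated workload of slots before $t$, and of the initial backlog) and of the prediction queues $A_{i,w}(t)$, $0\le w\le W_i-1$ (untreated workload that will arrive in slot $t+w$); at $t=0$ the predicted workload is all untreated. The integrate queue is served first-in-first-out without wasting capacity. $\boldsymbol W=\boldsymbol 0$ is the case without prediction. The latency of a unit of workload is the number of slots that it spends in $A_{i,-1}$. The steady-state probability of latency $w$ at node $i$ (with $\lambda_i>0$)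 is the almost sure long-run fraction of the workload of node $i$ that has latency $w$; these fractions have to form a probability distribution over $w\ge 0$. The average latency of steady-state probabilities $\pi$ is $\sum_i\lambda_i\sum_{w\ge1}w\pi_{i,w}/\sum_i\lambda_i$. **Theorem 2.** Suppose that the system without prediction has steady-state latency probabilities $\pi_{i,w}$ which depend only on the statistics of the arrival and service processes: they are the same for all arrival processes and environments that are distributed as the given ones, and for all nonnegative initial backlogs independent of these. Let $d$ be the average latency of $\pi$. Then for all windows $\boldsymbol W$ the system with perfect prediction has steady-state latency probabilities too, in the same sense. Let $d^{p}(\boldsymbol W)$ be their average latency. The latency reduction $\eta(\boldsymbol W)=d-d^{p}(\boldsymbol W)$ is $$\eta(\boldsymbol W)=\frac{\sum_{i\in\mathcal N}\lambda_i\Bigl(\sum_{1\le w\le W_i}w\,\pi_{i,w}+W_i\sum_{w\ge1}\pi_{i,w+W_i}\Bigr)}{\sum_{i\in\mathcal N}\lambda_i}.$$ Here $d^{p}(\boldsymbol W)<\infty$ if $d<\infty$. Whether or not $d$ is finite, the right-hand side is the limit, as $K\to\infty$, of the difference of the two average latencies when every latency above $K$ is counted as $K$. Moreover, if $d<\infty$,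 then $\eta(\boldsymbol W)\to d$ as $\boldsymbol W\to\infty$ (all $W_i\to\infty$). -/

import Mathlib

open MeasureTheory ProbabilityTheory Filter Topology
open scoped ENNReal

/-- The three queues whose backlogs are compared at every fog node: `arr` is the integrate queue of
an edge node, respectively the arrival queue of a central node; `loc` is the local processing
queue; `off` is the offloading queue. -/
inductive QueueKind
  | arr
  | loc
  | off

/-- Backlogs of all fog nodes. Edge fog nodes are `Sum.inl i`, central fog nodes `Sum.inr j`. -/
abbrev Backlog (N M : Type*) := N ⊕ M → QueueKind → ℝ

/-- State of the environment in one slot: the wireless channel gains between edge and central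
nodes, and the transmission capacities of the links from the central nodes to the cloud. -/
abbrev Environment (N M : Type*) := (N → M → ℝ) × (M → ℝ)

/-- Constants of a two-tier fog system with edge nodes `N` and central nodes `M`. -/
structure FogNetwork (N M : Type*) where
  /-- central nodes accessible from an edge node -/
  access : N → Finset M
  /-- slot length -/
  slotLength : ℝ
  /-- channel bandwidth -/
  bandwidth : ℝ
  /-- noise power spectral density -/
  noise : ℝ
  /-- hardware constant of the cubic CPU power consumption -/
  cpuCoeff : ℝ
  /-- trade-off parameter of the algorithm -/
  V : ℝ
  /-- CPU cycles per unit of workload -/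
  cycles : N ⊕ M → ℝ
  /-- maximal CPU frequency -/
  maxFreq : N ⊕ M → ℝ
  /-- maximal amount per slot from the integrate / arrival queue to the local queue -/
  maxLoc : N ⊕ M → ℝ
  /-- maximal amount per slot from the integrate / arrival queue to the offloading queue -/
  maxOff : N ⊕ M → ℝ
  /-- total transmit power bound of an edge node -/
  maxPower : N → ℝ
  slotLength_pos : 0 < slotLength
  bandwidth_pos : 0 < bandwidth
  noise_pos : 0 < noise
  cpuCoeff_pos : 0 < cpuCoeff
  V_pos : 0 < V
  cycles_pos : ∀ k, 0 < cycles k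
  maxFreq_pos : ∀ k, 0 < maxFreq k
  maxLoc_pos : ∀ k, 0 < maxLoc k
  maxOff_pos : ∀ k, 0 < maxOff k
  maxPower_pos : ∀ i, 0 < maxPower i

noncomputable section

namespace FogNetwork

variable {N M : Type*} (net : FogNetwork N M)

/-- Decision of PORA: capacity granted from the integrate / arrival queue to the local queue. -/
def locCapacity (Q : Backlog N M) (k : N ⊕ M) : ℝ :=
  open Classical in if Q k .loc < Q k .arr then net.maxLoc k else 0

/-- Decision of PORA: capacity granted from the integrate / arrival queue to the offloading
queue. -/
def offCapacity (Q : Backlog N M) (k : N ⊕ M) : ℝ :=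
  open Classical in if Q k .off < Q k .arr then net.maxOff k else 0

/-- Total output capacity of the integrate / arrival queue of a node. -/
def outCapacity (Q : Backlog N M) (k : N ⊕ M) : ℝ :=
  net.locCapacity Q k + net.offCapacity Q k

/-- Decision of PORA: CPU frequency. -/
def cpuFrequency (Q : Backlog N M) (k : N ⊕ M) : ℝ :=
  min (Real.sqrt (Q k .loc / (3 * net.V * net.cpuCoeff * net.cycles k))) (net.maxFreq k)

/-- Local processing capacity of a node in one slot. -/
def cpuCapacity (Q : Backlog N M) (k : N ⊕ M) : ℝ :=
  net.slotLength * net.cpuFrequency Q k / net.cycles k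

/-- Shannon capacity of one slot at transmit power `p` and channel gain `h`. -/
def rate (p h : ℝ) : ℝ :=
  net.slotLength * net.bandwidth * Real.logb 2 (1 + p * h / (net.noise * net.bandwidth))

/-- Feasible transmit powers of edge node `i` towards its accessible central nodes. -/
def feasiblePowers (i : N) : Set (M → ℝ) :=
  {p | (∀ j ∈ net.access i, 0 ≤ p j) ∧ ∑ j ∈ net.access i, p j ≤ net.maxPower i}

/-- Objective that PORA minimizes over the feasible transmit powers of edge node `i`. -/
def powerObjective (Q : Backlog N M) (e : Environment N M) (i : N) (p : M → ℝ) : ℝ :=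
  ∑ j ∈ net.access i,
    (net.V * p j - (Q (.inl i) .off - Q (.inr j) .arr) * net.bandwidth *
      Real.logb 2 (1 + e.1 i j / (net.noise * net.bandwidth) * p j))

end FogNetwork

/-- A rule for everything in a slot that is not given by a closed formula: the transmit powers, and
the amounts of workload that are really moved when a queue holds less than the granted capacity
(the distributing strategy). -/
structure OffloadingRule (N M : Type*) where
  /-- transmit power from an edge to a central node -/
  power : Backlog N M → Environment N M → N → M → ℝ
  /-- amount moved from the integrate / arrival queue to the local queue of a node -/
  toLoc : Backlog N M → Environment N M → N ⊕ M → ℝ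
  /-- amount moved from the integrate / arrival queue to the offloading queue of a node -/
  toOff : Backlog N M → Environment N M → N ⊕ M → ℝ
  /-- amount sent from the offloading queue of an edge node to a central node -/
  send : Backlog N M → Environment N M → N → M → ℝ

namespace OffloadingRule

variable {N M : Type*}

/-- Transmission capacity from edge node `i` to central node `j` under a rule. -/
def linkRate (net : FogNetwork N M) (rule : OffloadingRule N M)
    (Q : Backlog N M) (e : Environment N M) (i : N) (j : M) : ℝ :=
  net.rate (rule.power Q e i j) (e.1 i j)

/-- The rule implements PORA: the transmit powers of each edge node solve its power allocation
problem, and the granted capacities are used as far as the backlogs permit. How the moved workload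
is divided when there is less of it than capacity is left free. -/
structure IsPORA (net : FogNetwork N M) (rule : OffloadingRule N M) : Prop where
  power_feasible : ∀ Q e, (∀ k β, 0 ≤ Q k β) → (∀ i j, 0 ≤ e.1 i j) →
    ∀ i, rule.power Q e i ∈ net.feasiblePowers i
  power_optimal : ∀ Q e, (∀ k β, 0 ≤ Q k β) → (∀ i j, 0 ≤ e.1 i j) →
    ∀ i, IsMinOn (net.powerObjective Q e i) (net.feasiblePowers i) (rule.power Q e i)
  toLoc_mem : ∀ Q e, (∀ k β, 0 ≤ Q k β) → (∀ i j, 0 ≤ e.1 i j) →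
    ∀ k, rule.toLoc Q e k ∈ Set.Icc 0 (net.locCapacity Q k)
  toOff_mem : ∀ Q e, (∀ k β, 0 ≤ Q k β) → (∀ i j, 0 ≤ e.1 i j) →
    ∀ k, rule.toOff Q e k ∈ Set.Icc 0 (net.offCapacity Q k)
  toLoc_add_toOff : ∀ Q e, (∀ k β, 0 ≤ Q k β) → (∀ i j, 0 ≤ e.1 i j) →
    ∀ k, rule.toLoc Q e k + rule.toOff Q e k = min (Q k .arr) (net.outCapacity Q k)
  send_mem : ∀ Q e, (∀ k β, 0 ≤ Q k β) → (∀ i j, 0 ≤ e.1 i j) →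
    ∀ i, ∀ j ∈ net.access i, rule.send Q e i j ∈ Set.Icc 0 (rule.linkRate net Q e i j)
  send_eq_zero : ∀ Q e, (∀ k β, 0 ≤ Q k β) → (∀ i j, 0 ≤ e.1 i j) →
    ∀ i, ∀ j ∉ net.access i, rule.send Q e i j = 0
  sum_send : ∀ Q e, (∀ k β, 0 ≤ Q k β) → (∀ i j, 0 ≤ e.1 i j) →
    ∀ i, ∑ j ∈ net.access i, rule.send Q e i j =
      min (Q (.inl i) .off) (∑ j ∈ net.access i, rule.linkRate net Q e i j)

end OffloadingRule

/-- State of the system at the beginning of slot `t`. Workload waiting at an edge node is recorded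
by the slot in which it arrives: `rem i s` is the untreated part of the workload that arrives at
node `i` in slot `s`, and `old i` is the untreated part of what was in the arrival queue at time
`0`. So the prediction queue `A_{i,w}(t)` is `rem i (t + w)` for `w < W i`, the arrival queue
`A_{i,-1}(t)` is `old i + ∑ s < t, rem i s`, and the integrate queue is the sum of all of them. -/
structure FogState (N M : Type*) where
  old : N → ℝ
  rem : N → ℕ → ℝ
  backlog : Backlog N M

/-- First-in-first-out service: the part that is served of the workload of slot `s`, if `u s` is
untreated of slot `s`, `a` is even older, and the total service capacity is `c`. -/
def fifoServed (c a : ℝ) (u : ℕ → ℝ) (s : ℕ) : ℝ :=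
  min (u s) (max (c - (a + ∑ r ∈ Finset.range s, u r)) 0)

section Dynamics

variable {N M : Type*} [Fintype N]

/-- The system at time `0`: initial backlogs `x` (where the entry `arr` of an edge node is the
content of its arrival queue), and prediction queues which hold the arrivals of the first `W i`
slots, all untreated. -/
def initialState (W : N → ℕ) (A : ℕ → N → ℝ) (x : Backlog N M) : FogState N M where
  old i := x (.inl i) .arr
  rem i s := if s < W i then A s i else 0
  backlog
    | .inl i, .arr => x (.inl i) .arr + ∑ s ∈ Finset.range (W i), A s i
    | k, β => x k β

/-- Evolution from slot `t` to slot `t + 1` with prediction windows `W`, arrivals `A` (perfectly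
predicted) and environment `e` in slot `t`. -/
def nextState (net : FogNetwork N M) (rule : OffloadingRule N M) (W : N → ℕ)
    (A : ℕ → N → ℝ) (e : Environment N M) (t : ℕ) (S : FogState N M) : FogState N M :=
  let Q := S.backlog
  let old' : N → ℝ := fun i => max (S.old i - net.outCapacity Q (.inl i)) 0
  let rem' : N → ℕ → ℝ := fun i s =>
    if s < t + W i then
      S.rem i s - fifoServed (net.outCapacity Q (.inl i)) (S.old i) (S.rem i) s
    else if s = t + W i then A s i
    else 0
  { old := old'
    rem := rem'
    backlog := fun k β =>
      match k, β with
      | .inl i, .arr => old' i + ∑ s ∈ Finset.range (t + 1 + W i), rem' i s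
      | .inr j, .arr =>
          max (Q (.inr j) .arr - net.outCapacity Q (.inr j)) 0 + ∑ i, rule.send Q e i j
      | k, .loc => max (Q k .loc - net.cpuCapacity Q k) 0 + rule.toLoc Q e k
      | .inl i, .off =>
          max (Q (.inl i) .off - ∑ j ∈ net.access i, rule.linkRate net Q e i j) 0
            + rule.toOff Q e (.inl i)
      | .inr j, .off => max (Q (.inr j) .off - e.2 j) 0 + rule.toOff Q e (.inr j) }

/-- The trajectory of the system: prediction windows `W` (with `W = 0` there is no prediction),
arrivals `A t i`, environment `E t`, initial backlogs `x`. -/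
def trajectory (net : FogNetwork N M) (rule : OffloadingRule N M) (W : N → ℕ)
    (A : ℕ → N → ℝ) (E : ℕ → Environment N M) (x : Backlog N M) : ℕ → FogState N M
  | 0 => initialState W A x
  | t + 1 => nextState net rule W A (E t) t (trajectory net rule W A E x t)

/-- Amount of the workload arriving at node `i` in slot `s` whose latency in the arrival queue is
exactly `w`, that is, which is in `A_{i,-1}(t)` for exactly `w` slots `t`. What is not treated
by the end of slot `s` enters `A_{i,-1}(s + 1)`, so a latency of at least `w ≥ 1` means untreated
at the beginning of slot `s + w`. -/
def workloadOfLatency (net : FogNetwork N M) (rule : OffloadingRule N M) (W : N → ℕ)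
    (A : ℕ → N → ℝ) (E : ℕ → Environment N M) (x : Backlog N M) (i : N) (s w : ℕ) : ℝ :=
  (if w = 0 then A s i else (trajectory net rule W A E x (s + w)).rem i s)
    - (trajectory net rule W A E x (s + w + 1)).rem i s

end Dynamics

section Stochastic

variable {N M Ω : Type*} [Fintype N] [MeasurableSpace Ω]

/-- Standing assumptions on the random arrivals `A ω t i` with mean rates `lam i` and on the random
environment `E ω t`: arrivals are nonnegative, bounded, independent over slots and nodes, with a
law that does not depend on the slot; channel gains and link capacities are nonnegative and
bounded; arrivals and environment are independent of each other. -/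
structure IsInput (μ : Measure Ω) (lam : N → ℝ) (A : Ω → ℕ → N → ℝ)
    (E : Ω → ℕ → Environment N M) : Prop where
  measurable_arrivals : Measurable A
  measurable_environment : Measurable E
  arrivals_nonneg : ∀ ω t i, 0 ≤ A ω t i
  arrivals_bounded : ∃ C, ∀ ω t i, A ω t i ≤ C
  gains_nonneg : ∀ ω t i j, 0 ≤ (E ω t).1 i j
  gains_bounded : ∃ C, ∀ ω t i j, (E ω t).1 i j ≤ C
  links_nonneg : ∀ ω t j, 0 ≤ (E ω t).2 j
  links_bounded : ∃ C, ∀ ω t j, (E ω t).2 j ≤ C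
  arrivals_indep : iIndepFun (fun (q : ℕ × N) ω => A ω q.1 q.2) μ
  arrivals_identDistrib : ∀ t i, IdentDistrib (fun ω => A ω t i) (fun ω => A ω 0 i) μ μ
  mean_arrivals : ∀ t i, ∫ ω, A ω t i ∂μ = lam i
  arrivals_indep_environment : IndepFun A E μ

/-- `π i w` is the steady-state probability that a unit of workload of node `i` has latency `w`, in
the system with input `A`, `E` started from the initial backlogs `x`: it is almost surely the
long-run fraction of the workload of node `i` that has latency `w` in the arrival queue, and
`π i` is a probability distribution. (Nothing is required of nodes without workload.) -/
def IsSteadyLatency (net : FogNetwork N M) (rule : OffloadingRule N M) (μ : Measure Ω)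
    (lam : N → ℝ) (W : N → ℕ) (A : Ω → ℕ → N → ℝ) (E : Ω → ℕ → Environment N M)
    (x : Ω → Backlog N M) (π : N → ℕ → ℝ) : Prop :=
  ∀ i, 0 < lam i →
    HasSum (π i) 1 ∧
    ∀ᵐ ω ∂μ, ∀ w, Tendsto
      (fun T : ℕ =>
        (∑ s ∈ Finset.range T, workloadOfLatency net rule W (A ω) (E ω) (x ω) i s w)
          / ∑ s ∈ Finset.range T, A ω s i)
      atTop (𝓝 (π i w))

/-- The system with prediction windows `W` has the steady-state latency probabilities `π`, and they
depend only on the statistics of the arrivals and of the environment: they are the same for all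
realizations of arrivals and environment with the laws of `A` and `E`, and for all initial
backlogs that are independent of them. -/
def SteadyLatencyFromStatistics (net : FogNetwork N M) (rule : OffloadingRule N M)
    (μ : Measure Ω) (lam : N → ℝ) (W : N → ℕ) (A : Ω → ℕ → N → ℝ)
    (E : Ω → ℕ → Environment N M) (π : N → ℕ → ℝ) : Prop :=
  ∀ (A' : Ω → ℕ → N → ℝ) (E' : Ω → ℕ → Environment N M) (x : Ω → Backlog N M),
    IsInput μ lam A' E' → IdentDistrib A' A μ μ → IdentDistrib E' E μ μ →
    Measurable x → (∀ ω k β, 0 ≤ x ω k β) → IndepFun x (fun ω => (A' ω, E' ω)) μ →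
    IsSteadyLatency net rule μ lam W A' E' x π

end Stochastic

section Averages

variable {N : Type*} [Fintype N]

/-- Average arrival-queue latency over all nodes, possibly infinite. -/
def averageLatency (lam : N → ℝ) (π : N → ℕ → ℝ) : ℝ≥0∞ :=
  (∑ i, ENNReal.ofReal (lam i) * ∑' w : ℕ, (w : ℝ≥0∞) * ENNReal.ofReal (π i w))
    / ∑ i, ENNReal.ofReal (lam i)

/-- Average arrival-queue latency when every latency above `K` is counted as `K`. -/
def truncatedLatency (lam : N → ℝ) (π : N → ℕ → ℝ) (K : ℕ) : ℝ :=
  (∑ i, lam i * ∑' w : ℕ, (min w K : ℕ) * π i w) / ∑ i, lam i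

/-- The claimed value of the latency reduction for prediction windows `W`. -/
def reductionFormula (lam : N → ℝ) (π : N → ℕ → ℝ) (W : N → ℕ) : ℝ :=
  (∑ i, lam i * (∑ w ∈ Finset.Icc 1 (W i), (w : ℝ) * π i w
      + (W i : ℝ) * ∑' w : ℕ, π i (w + 1 + W i)))
    / ∑ i, lam i

end Averages

end

/-! Every decision in a slot is a function of the current backlogs and environment, and the
integrate queue enters only through its total. So, path by path, the system with windows `W` is the
system without prediction whose arrivals at node `i` come `W i` slots earlier and whose initial
backlog already contains the first `W i` arrivals (`trajectory_coupling`). Under first-in-first-out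
service the same workload is treated in the same slot, so latency `w` in the coupled system becomes
`w - W i`, cut off at `0`.

The advanced arrivals have the original law, and the enlarged initial backlog is independent of them
and of the environment (`IsInput.identDistrib_advance`, `IsInput.indepFun_advancedBacklog`). The
hypothesis therefore applies to the coupled system and gives it the same `π`; prediction turns `π i`
into `shiftDown (π i) (W i)` (`IsSteadyLatency.shiftDown`). The reduction is then the mean of `w -
(w - W i)⁺ = min w (W i)`, which `tsum_min_mul` rewrites as the stated formula. -/

/-! ### Pathwise coupling with a system without prediction -/

section Coupling

variable {N M : Type*}

/-- Arrivals in which those of node `i` are advanced by `W i` slots. -/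
def advancedArrivals (W : N → ℕ) (A : ℕ → N → ℝ) : ℕ → N → ℝ := fun t i => A (t + W i) i

/-- Initial backlogs in which the arrivals of the first `W i` slots have already been added to the
arrival queue of edge node `i`. -/
noncomputable def advancedBacklog (W : N → ℕ) (A : ℕ → N → ℝ) (x : Backlog N M) : Backlog N M
  | .inl i, .arr => x (.inl i) .arr + ∑ s ∈ Finset.range (W i), A s i
  | k, β => x k β

lemma fifoServed_le (c a : ℝ) (u : ℕ → ℝ) (s : ℕ) : fifoServed c a u s ≤ u s := min_le_left _ _

lemma fifoServed_nonneg {c a : ℝ} {u : ℕ → ℝ} {s : ℕ} (hu : 0 ≤ u s) :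
    0 ≤ fifoServed c a u s := le_min hu (le_max_right _ _)

/-- First-in-first-out service wastes no capacity. -/
lemma max_add_sum_sub_fifoServed (c a : ℝ) (u : ℕ → ℝ) (hu : ∀ s, 0 ≤ u s) (n : ℕ) :
    max (a - c) 0 + ∑ s ∈ Finset.range n, (u s - fifoServed c a u s)
      = max (a + ∑ s ∈ Finset.range n, u s - c) 0 := by
  induction n with
  | zero => simp
  | succ n ih =>
    rw [Finset.sum_range_succ, ← add_assoc, ih, Finset.sum_range_succ, fifoServed]
    have h := hu n
    generalize ∑ s ∈ Finset.range n, u s = S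
    -- Either capacity is left over for slot `n`, or older workload exhausts it and slot `n` is
    -- untouched.
    rcases le_total (a + S) c with h1 | h1
    · rw [max_eq_right (by linarith : a + S - c ≤ 0),
        max_eq_left (by linarith : 0 ≤ c - (a + S))]
      rcases le_total (u n) (c - (a + S)) with h2 | h2
      · rw [min_eq_left h2, max_eq_right (by linarith)]; ring
      · rw [min_eq_right h2, max_eq_left (by linarith)]; ring
    · rw [max_eq_left (by linarith : 0 ≤ a + S - c),
        max_eq_right (by linarith : c - (a + S) ≤ 0), min_eq_right h, max_eq_left (by linarith)]
      ring

/-- Service of a slot sees older workload only through its total, so the first `n` slots can be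
merged into the older amount. The coupling merges the initially predicted slots into `old` in this
way. -/
lemma fifoServed_add (c a : ℝ) (u : ℕ → ℝ) (n s : ℕ) :
    fifoServed c a u (s + n)
      = fifoServed c (a + ∑ r ∈ Finset.range n, u r) (fun r => u (r + n)) s := by
  simp only [fifoServed]
  rw [add_comm s n, Finset.sum_range_add, add_assoc, add_comm n s]
  simp only [add_comm n]

variable [Fintype N] (net : FogNetwork N M) (rule : OffloadingRule N M) (W : N → ℕ)
  (A : ℕ → N → ℝ) (E : ℕ → Environment N M) (x : Backlog N M)

lemma rem_nonneg (hA : ∀ t i, 0 ≤ A t i) (t : ℕ) (i : N) (s : ℕ) :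
    0 ≤ (trajectory net rule W A E x t).rem i s := by
  induction t generalizing s with
  | zero =>
    simp only [trajectory, initialState]
    split_ifs
    exacts [hA _ _, le_rfl]
  | succ t ih =>
    simp only [trajectory, nextState]
    split_ifs
    exacts [sub_nonneg.2 (fifoServed_le _ _ _ _), hA _ _, le_rfl]

lemma rem_succ_le (hA : ∀ t i, 0 ≤ A t i) {t : ℕ} {i : N} {s : ℕ} (h : s < t + W i) :
    (trajectory net rule W A E x (t + 1)).rem i s ≤ (trajectory net rule W A E x t).rem i s := by
  simp only [trajectory, nextState, if_pos h]
  exact sub_le_self _ (fifoServed_nonneg (rem_nonneg net rule W A E x hA t i s))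

lemma rem_succ_eq_arrivals (i : N) (s : ℕ) :
    (trajectory net rule 0 A E x (s + 1)).rem i s = A s i := by
  simp [trajectory, nextState]

lemma workloadOfLatency_nonneg (hA : ∀ t i, 0 ≤ A t i) (i : N) (s w : ℕ) :
    0 ≤ workloadOfLatency net rule 0 A E x i s w := by
  rcases w with _ | w
  · simp [workloadOfLatency, rem_succ_eq_arrivals]
  · simp only [workloadOfLatency, Nat.add_eq_zero_iff, one_ne_zero, and_false, if_false,
      sub_nonneg]
    exact rem_succ_le net rule 0 A E x hA (by simp only [Pi.zero_apply]; omega)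

/-- The system with perfect prediction is a system without prediction whose arrivals are
advanced. -/
lemma trajectory_coupling (hA : ∀ t i, 0 ≤ A t i) (t : ℕ) :
    (trajectory net rule W A E x t).backlog
        = (trajectory net rule 0 (advancedArrivals W A) E (advancedBacklog W A x) t).backlog ∧
      (∀ i s, (trajectory net rule W A E x t).rem i (s + W i)
        = (trajectory net rule 0 (advancedArrivals W A) E (advancedBacklog W A x) t).rem i s) ∧
      ∀ i, (trajectory net rule W A E x t).old i
          + ∑ r ∈ Finset.range (W i), (trajectory net rule W A E x t).rem i r
        = (trajectory net rule 0 (advancedArrivals W A) E (advancedBacklog W A x) t).old i := by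
  induction t with
  | zero =>
    refine ⟨?_, ?_, ?_⟩
    · funext k β
      rcases k with i | j <;> cases β <;> simp [trajectory, initialState, advancedBacklog]
    · intro i s
      simp [trajectory, initialState]
    · intro i
      simp only [trajectory, initialState, advancedBacklog]
      congr 1
      exact Finset.sum_congr rfl fun s hs => if_pos (Finset.mem_range.1 hs)
  | succ t ih =>
    have hnn := fun i s => rem_nonneg net rule W A E x hA t i s
    simp only [trajectory]
    generalize trajectory net rule W A E x t = P at *
    generalize trajectory net rule 0 (advancedArrivals W A) E (advancedBacklog W A x) t = Z at *
    obtain ⟨hb, hr, ho⟩ := ih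
    have hrem : ∀ i s, (nextState net rule W A (E t) t P).rem i (s + W i)
        = (nextState net rule 0 (advancedArrivals W A) (E t) t Z).rem i s := by
      intro i s
      simp only [nextState, advancedArrivals, fifoServed_add, hr, ho, hb, Pi.zero_apply,
        add_lt_add_iff_right, add_left_inj, add_zero]
    have hold : ∀ i, (nextState net rule W A (E t) t P).old i
          + ∑ r ∈ Finset.range (W i), (nextState net rule W A (E t) t P).rem i r
        = (nextState net rule 0 (advancedArrivals W A) (E t) t Z).old i := by
      intro i
      simp only [nextState]
      rw [← ho i, ← hb, ← max_add_sum_sub_fifoServed _ _ _ (hnn i)]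
      congr 1
      -- Slots before `W i` were in the prediction window at time `0`, so they always fall in the
      -- service branch.
      refine Finset.sum_congr rfl fun s hs => if_pos ?_
      have := Finset.mem_range.1 hs
      omega
    refine ⟨?_, hrem, hold⟩
    funext k β
    have harr : ∀ i, (nextState net rule W A (E t) t P).old i
          + ∑ s ∈ Finset.range (t + 1 + W i), (nextState net rule W A (E t) t P).rem i s
        = (nextState net rule 0 (advancedArrivals W A) (E t) t Z).old i
          + ∑ s ∈ Finset.range (t + 1 + 0),
            (nextState net rule 0 (advancedArrivals W A) (E t) t Z).rem i s := by
      intro i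
      -- The first `W i` slots count as old workload in the coupled system; the others match after a
      -- shift by `W i`.
      rw [add_comm (t + 1) (W i), Finset.sum_range_add, ← add_assoc, hold, add_zero]
      congr 1
      refine Finset.sum_congr rfl fun s _ => ?_
      rw [add_comm, hrem]
    rcases k with i | j <;> cases β
    · exact harr i
    all_goals simp only [nextState, hb]

lemma workloadOfLatency_add_of_pos (hA : ∀ t i, 0 ≤ A t i) (i : N) (s : ℕ) {w : ℕ} (hw : w ≠ 0) :
    workloadOfLatency net rule W A E x i (s + W i) w
      = workloadOfLatency net rule 0 (advancedArrivals W A) E (advancedBacklog W A x) i s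
          (w + W i) := by
  have h : w + W i ≠ 0 := by omega
  simp only [workloadOfLatency, if_neg hw, if_neg h]
  rw [(trajectory_coupling net rule W A E x hA _).2.1,
    (trajectory_coupling net rule W A E x hA _).2.1,
    add_assoc s, add_comm (W i)]

/-- The sum telescopes, starting from the full arrival because of the special case `w = 0`. -/
lemma sum_workloadOfLatency (i : N) (s n : ℕ) :
    ∑ v ∈ Finset.range (n + 1), workloadOfLatency net rule W A E x i s v
      = A s i - (trajectory net rule W A E x (s + n + 1)).rem i s := by
  induction n with
  | zero => simp [workloadOfLatency]
  | succ n ih =>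
    rw [Finset.sum_range_succ, ih]
    simp [workloadOfLatency, ← add_assoc]

/-- Latency at most `W i` in the coupled system means treated by the end of slot `s + W i`, the true
arrival slot, hence never in the arrival queue. -/
lemma workloadOfLatency_add_zero (hA : ∀ t i, 0 ≤ A t i) (i : N) (s : ℕ) :
    workloadOfLatency net rule W A E x i (s + W i) 0
      = ∑ v ∈ Finset.range (W i + 1), workloadOfLatency net rule 0 (advancedArrivals W A) E
          (advancedBacklog W A x) i s v := by
  rw [sum_workloadOfLatency]
  simp only [workloadOfLatency, if_true, add_zero]
  rw [(trajectory_coupling net rule W A E x hA _).2.1]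
  rfl

end Coupling

/-! ### Two facts on independence -/

section Independence

variable {Ω : Type*} [MeasurableSpace Ω] {μ : Measure Ω}

/-- The hypotheses make the joint law of the three a product of three measures, which can be
reassociated. -/
lemma ProbabilityTheory.IndepFun.prodMk_left_of_right [IsProbabilityMeasure μ]
    {α β γ : Type*} [MeasurableSpace α] [MeasurableSpace β] [MeasurableSpace γ] {X : Ω → α}
    {Y : Ω → β} {Z : Ω → γ}
    (hX : Measurable X) (hY : Measurable Y) (hZ : Measurable Z)
    (h : IndepFun X (fun ω => (Y ω, Z ω)) μ) (h' : IndepFun Y Z μ) :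
    IndepFun (fun ω => (X ω, Y ω)) Z μ := by
  have : IsProbabilityMeasure (μ.map X) := Measure.isProbabilityMeasure_map hX.aemeasurable
  have : IsProbabilityMeasure (μ.map Y) := Measure.isProbabilityMeasure_map hY.aemeasurable
  have : IsProbabilityMeasure (μ.map Z) := Measure.isProbabilityMeasure_map hZ.aemeasurable
  have hXY : IndepFun X Y μ := h.comp measurable_id measurable_fst
  rw [indepFun_iff_map_prod_eq_prod_map_map (hX.prodMk hY).aemeasurable hZ.aemeasurable,
    hXY.map_prod_eq_prod_map_map hX.aemeasurable hY.aemeasurable]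
  have e : (fun ω => ((X ω, Y ω), Z ω))
      = MeasurableEquiv.prodAssoc.symm ∘ fun ω => (X ω, (Y ω, Z ω)) := rfl
  rw [e, ← Measure.map_map MeasurableEquiv.prodAssoc.symm.measurable (hX.prodMk (hY.prodMk hZ)),
    h.map_prod_eq_prod_map_map hX.aemeasurable (hY.prodMk hZ).aemeasurable,
    h'.map_prod_eq_prod_map_map hY.aemeasurable hZ.aemeasurable]
  exact ((measurePreserving_prodAssoc (μ.map X) (μ.map Y) (μ.map Z)).symm _).map_eq

/-- Functions of disjoint subfamilies of an independent family are independent. -/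
lemma ProbabilityTheory.iIndepFun.indepFun_of_disjoint {ι α β : Type*} [MeasurableSpace α]
    [MeasurableSpace β] {X : ι → Ω → ℝ} (hX : ∀ q, Measurable (X q)) (h : iIndepFun X μ)
    {S T : Set ι} (hST : Disjoint S T) {Y : Ω → α} {Z : Ω → β}
    (hY : Measurable[⨆ q ∈ S, MeasurableSpace.comap (X q) inferInstance] Y)
    (hZ : Measurable[⨆ q ∈ T, MeasurableSpace.comap (X q) inferInstance] Z) :
    IndepFun Y Z μ :=
  (IndepFun_iff_Indep _ _ _).2 <| indep_of_indep_of_le_left (indep_of_indep_of_le_right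
    (indep_iSup_of_disjoint (fun q => (hX q).comap_le) h hST) hZ.comap_le) hY.comap_le

end Independence

/-! ### The coupled system is an admissible input -/

section AdvancedInput

variable {N M Ω : Type*} [MeasurableSpace Ω] {μ : Measure Ω}
  {lam : N → ℝ} {A : Ω → ℕ → N → ℝ} {E : Ω → ℕ → Environment N M}

lemma measurable_advancedArrivals (W : N → ℕ) :
    Measurable (advancedArrivals W : (ℕ → N → ℝ) → ℕ → N → ℝ) :=
  measurable_pi_lambda _ fun t => measurable_pi_lambda _ fun i =>
    (measurable_pi_apply i).comp (measurable_pi_apply (t + W i))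

lemma IsInput.measurable_arrival (h : IsInput μ lam A E) (q : ℕ × N) :
    Measurable fun ω => A ω q.1 q.2 :=
  (measurable_pi_apply q.2).comp ((measurable_pi_apply q.1).comp h.measurable_arrivals)

lemma injective_advance (W : N → ℕ) :
    Function.Injective fun q : ℕ × N => (q.1 + W q.2, q.2) := by
  rintro ⟨s, i⟩ ⟨t, j⟩ h
  simp only [Prod.mk.injEq] at h
  obtain ⟨h1, rfl⟩ := h
  simpa using h1

lemma IsInput.advance (h : IsInput μ lam A E) (W : N → ℕ) :
    IsInput μ lam (fun ω => advancedArrivals W (A ω)) E where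
  measurable_arrivals := (measurable_advancedArrivals W).comp h.measurable_arrivals
  measurable_environment := h.measurable_environment
  arrivals_nonneg ω _ i := h.arrivals_nonneg ω _ i
  arrivals_bounded := h.arrivals_bounded.imp fun _ hC ω _ i => hC ω _ i
  gains_nonneg := h.gains_nonneg
  gains_bounded := h.gains_bounded
  links_nonneg := h.links_nonneg
  links_bounded := h.links_bounded
  arrivals_indep := h.arrivals_indep.precomp (injective_advance W)
  arrivals_identDistrib t i :=
    (h.arrivals_identDistrib (t + W i) i).trans (h.arrivals_identDistrib (0 + W i) i).symm
  mean_arrivals t i := h.mean_arrivals (t + W i) i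
  arrivals_indep_environment :=
    h.arrivals_indep_environment.comp (measurable_advancedArrivals W) measurable_id

/-- Both arrays are independent families, so their laws are products of the marginals, and a
marginal depends only on the node. The argument runs over the index set `ℕ × N` and is curried at
the end. -/
lemma IsInput.identDistrib_advance [IsProbabilityMeasure μ] (h : IsInput μ lam A E) (W : N → ℕ) :
    IdentDistrib (fun ω => advancedArrivals W (A ω)) A μ μ := by
  have key : IdentDistrib (fun ω (q : ℕ × N) => A ω (q.1 + W q.2) q.2)
      (fun ω (q : ℕ × N) => A ω q.1 q.2) μ μ := by
    have hm := fun q => h.measurable_arrival q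
    have hm' := fun q => (h.advance W).measurable_arrival q
    refine ⟨(measurable_pi_lambda _ hm').aemeasurable, (measurable_pi_lambda _ hm).aemeasurable, ?_⟩
    have e1 := (iIndepFun_iff_map_fun_eq_infinitePi_map hm).1 h.arrivals_indep
    have e2 := (iIndepFun_iff_map_fun_eq_infinitePi_map hm').1 (h.advance W).arrivals_indep
    refine e2.trans (Eq.trans ?_ e1.symm)
    congr 1
    funext q
    exact ((h.arrivals_identDistrib (q.1 + W q.2) q.2).trans
      (h.arrivals_identDistrib q.1 q.2).symm).map_eq
  exact key.comp (u := fun (f : ℕ × N → ℝ) t i => f (t, i))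
    (measurable_pi_lambda _ fun t => measurable_pi_lambda _ fun i => measurable_pi_apply (t, i))

/-- The arrivals of the first `W i` slots at each node are independent of the later ones. -/
lemma IsInput.indepFun_sum_advance (h : IsInput μ lam A E) (W : N → ℕ) :
    IndepFun (fun ω i => ∑ s ∈ Finset.range (W i), A ω s i)
      (fun ω => advancedArrivals W (A ω)) μ := by
  have hle : ∀ (S : Set (ℕ × N)) (q : ℕ × N), q ∈ S →
      Measurable[⨆ q ∈ S, MeasurableSpace.comap (fun ω => A ω q.1 q.2) inferInstance]
        (fun ω => A ω q.1 q.2) := fun S q hq =>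
    measurable_iff_comap_le.2
      (le_iSup₂ (f := fun (q : ℕ × N) (_ : q ∈ S) =>
        MeasurableSpace.comap (fun ω => A ω q.1 q.2) inferInstance) q hq)
  refine h.arrivals_indep.indepFun_of_disjoint (fun q => h.measurable_arrival q)
    (disjoint_compl_right (a := {q : ℕ × N | q.1 < W q.2})) ?_ ?_
  -- Measurability is meant for the σ-algebra generated by the subfamily, so the ambient instance on
  -- `Ω` must not be inferred.
  · refine @measurable_pi_lambda _ _ _ (_) _ _ fun i => ?_
    exact Finset.measurable_fun_sum _ fun s hs => hle _ (s, i) (Finset.mem_range.1 hs)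
  · refine @measurable_pi_lambda _ _ _ (_) _ _ fun t => ?_
    refine @measurable_pi_lambda _ _ _ (_) _ _ fun i => ?_
    exact hle _ (t + W i, i) (by simp)

lemma measurable_backlog_add : Measurable fun p : Backlog N M × (N → ℝ) =>
    (fun k β => match k, β with
      | .inl i, .arr => p.1 (.inl i) .arr + p.2 i
      | k, β => p.1 k β : Backlog N M) := by
  have h : ∀ k β, Measurable fun p : Backlog N M × (N → ℝ) => p.1 k β := fun k β =>
    (measurable_pi_apply β).comp ((measurable_pi_apply k).comp measurable_fst)
  refine measurable_pi_lambda _ fun k => measurable_pi_lambda _ fun β => ?_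
  rcases k with i | j <;> cases β
  · exact (h _ _).add ((measurable_pi_apply i).comp measurable_snd)
  all_goals exact h _ _

lemma advancedBacklog_eq (W : N → ℕ) (a : ℕ → N → ℝ) (x : Backlog N M) :
    advancedBacklog W a x = (fun k β => match k, β with
      | .inl i, .arr => x (.inl i) .arr + (fun i => ∑ s ∈ Finset.range (W i), a s i) i
      | k, β => x k β : Backlog N M) := by
  funext k β
  rcases k with i | j <;> cases β <;> rfl

lemma advancedBacklog_nonneg {W : N → ℕ} {a : ℕ → N → ℝ} {x : Backlog N M}
    (ha : ∀ t i, 0 ≤ a t i) (hx : ∀ k β, 0 ≤ x k β) (k : N ⊕ M) (β : QueueKind) :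
    0 ≤ advancedBacklog W a x k β := by
  rcases k with i | j <;> cases β
  · exact add_nonneg (hx _ _) (Finset.sum_nonneg fun s _ => ha s i)
  all_goals exact hx _ _

lemma measurable_sum_arrivals (W : N → ℕ) :
    Measurable fun (a : ℕ → N → ℝ) i => ∑ s ∈ Finset.range (W i), a s i :=
  measurable_pi_lambda _ fun i => Finset.measurable_fun_sum _ fun s _ =>
    (measurable_pi_apply i).comp (measurable_pi_apply s)

lemma IsInput.measurable_advancedBacklog (h : IsInput μ lam A E) (W : N → ℕ)
    {x : Ω → Backlog N M} (hx : Measurable x) :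
    Measurable fun ω => advancedBacklog W (A ω) (x ω) := by
  simp only [advancedBacklog_eq]
  exact measurable_backlog_add.comp
    (hx.prodMk ((measurable_sum_arrivals W).comp h.measurable_arrivals))

lemma IsInput.indepFun_advancedBacklog [IsProbabilityMeasure μ] (h : IsInput μ lam A E)
    (W : N → ℕ) {x : Ω → Backlog N M} (hx : Measurable x)
    (hi : IndepFun x (fun ω => (A ω, E ω)) μ) :
    IndepFun (fun ω => advancedBacklog W (A ω) (x ω))
      (fun ω => (advancedArrivals W (A ω), E ω)) μ := by
  have hB := measurable_sum_arrivals (N := N) W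
  have hA' := measurable_advancedArrivals (N := N) W
  -- Write `B` for the sums of the first `W i` arrivals. The environment is independent of later
  -- arrivals and `B` jointly, and these two are independent of each other; regrouping separates `B`
  -- from the rest.
  have h1 : IndepFun (fun ω => (E ω, advancedArrivals W (A ω)))
      (fun ω i => ∑ s ∈ Finset.range (W i), A ω s i) μ :=
    IndepFun.prodMk_left_of_right h.measurable_environment (hA'.comp h.measurable_arrivals)
      (hB.comp h.measurable_arrivals)
      (h.arrivals_indep_environment.symm.comp measurable_id (hA'.prodMk hB))
      (h.indepFun_sum_advance W).symm
  have h2 : IndepFun (fun ω i => ∑ s ∈ Finset.range (W i), A ω s i)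
      (fun ω => (advancedArrivals W (A ω), E ω)) μ :=
    h1.symm.comp measurable_id measurable_swap
  -- A second regrouping puts `B` next to `x`; the enlarged backlog is a function of this pair.
  have h3 := IndepFun.prodMk_left_of_right hx (hB.comp h.measurable_arrivals)
      ((hA'.comp h.measurable_arrivals).prodMk h.measurable_environment)
      (hi.comp measurable_id ((hB.comp measurable_fst).prodMk
        ((hA'.comp measurable_fst).prodMk measurable_snd))) h2
  simp only [advancedBacklog_eq]
  exact h3.comp measurable_backlog_add measurable_id

end AdvancedInput

/-! ### Moments of a shifted distribution -/

section Shift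

/-- The distribution `p` moved down by `n`, where everything below `0` is put at `0`. -/
noncomputable def shiftDown (p : ℕ → ℝ) (n w : ℕ) : ℝ :=
  if w = 0 then ∑ v ∈ Finset.range (n + 1), p v else p (w + n)

lemma shiftDown_nonneg {p : ℕ → ℝ} (hp : ∀ w, 0 ≤ p w) (n w : ℕ) : 0 ≤ shiftDown p n w := by
  unfold shiftDown
  split_ifs
  exacts [Finset.sum_nonneg fun _ _ => hp _, hp _]

lemma shiftDown_succ (p : ℕ → ℝ) (n w : ℕ) : shiftDown p n (w + 1) = p (w + (n + 1)) := by
  simp only [shiftDown, Nat.add_eq_zero_iff, one_ne_zero, and_false, if_false]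
  congr 1
  omega

lemma hasSum_shiftDown_iff {p : ℕ → ℝ} {n : ℕ} {a : ℝ} : HasSum (shiftDown p n) a ↔ HasSum p a := by
  rw [← hasSum_nat_add_iff' 1, ← hasSum_nat_add_iff' (f := p) (n + 1)]
  simp only [shiftDown_succ, Finset.sum_range_one]
  simp [shiftDown]

/-- Change of variables along `w ↦ w - n`. The mass collapsed to `0` contributes nothing since `g 0
= 0`, and the remaining tails agree term by term. -/
lemma hasSum_mul_shiftDown_iff {g p : ℕ → ℝ} (hg : g 0 = 0) {n : ℕ} {a : ℝ} :
    HasSum (fun w => g w * shiftDown p n w) a ↔ HasSum (fun w => g (w - n) * p w) a := by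
  rw [← hasSum_nat_add_iff' 1, ← hasSum_nat_add_iff' (f := fun w => g (w - n) * p w) (n + 1)]
  simp only [shiftDown_succ, Finset.sum_range_one, hg, zero_mul]
  rw [Finset.sum_eq_zero (fun i hi => ?_)]
  · refine iff_of_eq (congrArg (HasSum · _) ?_)
    funext w
    congr 2
    omega
  · rw [Nat.sub_eq_zero_of_le (by have := Finset.mem_range.1 hi; omega), hg, zero_mul]

lemma tsum_mul_shiftDown {g p : ℕ → ℝ} (hg : g 0 = 0) (n : ℕ)
    (hs : Summable fun w => g (w - n) * p w) :
    ∑' w, g w * shiftDown p n w = ∑' w, g (w - n) * p w :=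
  ((hasSum_mul_shiftDown_iff hg).2 hs.hasSum).tsum_eq

variable {p : ℕ → ℝ}

lemma summable_mul_of_le (hp : ∀ w, 0 ≤ p w) (hs : Summable p) 
    {g : ℕ → ℝ} (C : ℝ) (h0 : ∀ w, 0 ≤ g w) (h1 : ∀ w, g w ≤ C) :
    Summable fun w => g w * p w :=
  (hs.mul_left C).of_nonneg_of_le (fun w => mul_nonneg (h0 w) (hp w))
    fun w => mul_le_mul_of_nonneg_right (h1 w) (hp w)

lemma summable_min_mul (hp : ∀ w, 0 ≤ p w) (hs : Summable p) (K : ℕ) :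
    Summable fun w : ℕ => ((min w K : ℕ) : ℝ) * p w :=
  summable_mul_of_le hp hs K (fun _ => Nat.cast_nonneg _)
    fun _ => Nat.cast_le.2 (min_le_right _ _)

lemma tsum_min_mul (hp : ∀ w, 0 ≤ p w) (hs : Summable p) (n : ℕ) :
    ∑' w : ℕ, ((min w n : ℕ) : ℝ) * p w
      = ∑ w ∈ Finset.Icc 1 n, (w : ℝ) * p w + (n : ℝ) * ∑' w : ℕ, p (w + 1 + n) := by
  rw [← (summable_min_mul hp hs n).sum_add_tsum_nat_add (n + 1), ← tsum_mul_left]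
  congr 1
  · rw [Finset.sum_range_succ', Finset.range_eq_Ico, Finset.sum_Ico_add' (fun w : ℕ =>
      ((min w n : ℕ) : ℝ) * p w) 0 n 1]
    simp only [zero_add, Nat.zero_min, Nat.cast_zero, zero_mul, add_zero]
    refine Finset.sum_congr (by ext; simp [Nat.succ_le_iff]) fun w hw => ?_
    rw [min_eq_left (Finset.mem_Icc.1 hw).2]
  · refine tsum_congr fun w => ?_
    rw [min_eq_right (by omega)]
    congr 2
    omega

/-- The difference `min w K - min (w - n) K` lies between `0` and `n` and equals `min w n` once `K ≥
w`. The majorant `n * p w` is summable without a finite mean, so the limit exists even for infinite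
average latency. -/
lemma tendsto_tsum_min_sub (hp : ∀ w, 0 ≤ p w) (hs : Summable p) (n : ℕ) :
    Tendsto (fun K : ℕ => ∑' w : ℕ, ((min w K : ℕ) : ℝ) * p w
        - ∑' w : ℕ, ((min w K : ℕ) : ℝ) * shiftDown p n w) atTop
      (𝓝 (∑' w : ℕ, ((min w n : ℕ) : ℝ) * p w)) := by
  have hs' : ∀ K : ℕ, Summable fun w : ℕ => ((min (w - n) K : ℕ) : ℝ) * p w := fun K =>
    summable_mul_of_le hp hs K (fun _ => Nat.cast_nonneg _)
      fun _ => Nat.cast_le.2 (min_le_right _ _)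
  have h : ∀ K : ℕ, ∑' w : ℕ, ((min w K : ℕ) : ℝ) * p w
        - ∑' w : ℕ, ((min w K : ℕ) : ℝ) * shiftDown p n w
      = ∑' w : ℕ, (((min w K : ℕ) : ℝ) - ((min (w - n) K : ℕ) : ℝ)) * p w := fun K => by
    rw [tsum_mul_shiftDown (g := fun w => ((min w K : ℕ) : ℝ)) (by simp) n (hs' K),
      ← (summable_min_mul hp hs K).tsum_sub (hs' K)]
    simp only [sub_mul]
  simp only [h]
  refine tendsto_tsum_of_dominated_convergence (hs.mul_left (n : ℝ)) (fun w => ?_) ?_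
  · refine tendsto_const_nhds.congr' ?_
    filter_upwards [eventually_ge_atTop w] with K hK
    rw [min_eq_left hK, min_eq_left (by omega : w - n ≤ K), sub_eq_of_eq_add]
    exact_mod_cast (by omega : w = min w n + (w - n))
  · refine Eventually.of_forall fun K w => ?_
    have h1 : ((min (w - n) K : ℕ) : ℝ) ≤ ((min w K : ℕ) : ℝ) := by
      exact_mod_cast (by omega : min (w - n) K ≤ min w K)
    have h2 : ((min w K : ℕ) : ℝ) ≤ n + ((min (w - n) K : ℕ) : ℝ) := by
      exact_mod_cast (by omega : min w K ≤ n + min (w - n) K)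
    rw [Real.norm_of_nonneg (mul_nonneg (sub_nonneg.2 h1) (hp w))]
    exact mul_le_mul_of_nonneg_right (by linarith) (hp w)

lemma summable_sub_mul (hp : ∀ w, 0 ≤ p w) 
    (hm : Summable fun w : ℕ => (w : ℝ) * p w) (n : ℕ) :
    Summable fun w : ℕ => ((w - n : ℕ) : ℝ) * p w :=
  hm.of_nonneg_of_le (fun w => mul_nonneg (Nat.cast_nonneg _) (hp w))
    fun w => mul_le_mul_of_nonneg_right (Nat.cast_le.2 (Nat.sub_le _ _)) (hp w)

lemma summable_mul_shiftDown (hp : ∀ w, 0 ≤ p w) 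
    (hm : Summable fun w : ℕ => (w : ℝ) * p w) (n : ℕ) :
    Summable fun w : ℕ => (w : ℝ) * shiftDown p n w :=
  ((hasSum_mul_shiftDown_iff (g := fun w => (w : ℝ)) Nat.cast_zero).2
    (summable_sub_mul hp hm n).hasSum).summable

lemma tsum_mul_sub_shiftDown (hp : ∀ w, 0 ≤ p w) 
    (hm : Summable fun w : ℕ => (w : ℝ) * p w) (n : ℕ) :
    ∑' w : ℕ, (w : ℝ) * p w - ∑' w : ℕ, (w : ℝ) * shiftDown p n w
      = ∑' w : ℕ, ((min w n : ℕ) : ℝ) * p w := by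
  rw [tsum_mul_shiftDown (g := fun w => (w : ℝ)) Nat.cast_zero n (summable_sub_mul hp hm n),
    ← hm.tsum_sub (summable_sub_mul hp hm n)]
  refine tsum_congr fun w => ?_
  rw [← sub_mul, sub_eq_of_eq_add]
  exact_mod_cast (by omega : w = min w n + (w - n))

lemma tendsto_tsum_min_mul (hp : ∀ w, 0 ≤ p w) 
    (hm : Summable fun w : ℕ => (w : ℝ) * p w) :
    Tendsto (fun n : ℕ => ∑' w : ℕ, ((min w n : ℕ) : ℝ) * p w) atTop
      (𝓝 (∑' w : ℕ, (w : ℝ) * p w)) := by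
  refine tendsto_tsum_of_dominated_convergence hm (fun w => ?_) ?_
  · refine tendsto_const_nhds.congr' ?_
    filter_upwards [eventually_ge_atTop w] with n hn
    rw [min_eq_left hn]
  · refine Eventually.of_forall fun n w => ?_
    rw [Real.norm_of_nonneg (mul_nonneg (Nat.cast_nonneg _) (hp w))]
    exact mul_le_mul_of_nonneg_right (Nat.cast_le.2 (min_le_left _ _)) (hp w)

end Shift

/-! ### Averages over the nodes -/

section Average

variable {N : Type*} [Fintype N] {lam : N → ℝ} {π : N → ℕ → ℝ}

/-- Nothing is known about `π i` at nodes without workload; there the factor `lam i = 0` removes the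
term, here and in the lemmas below. -/
lemma averageLatency_eq_ofReal (h0 : ∀ i, 0 ≤ lam i) (hlam : 0 < ∑ i, lam i)
    (hπ : ∀ i, 0 < lam i → ∀ w, 0 ≤ π i w)
    (hm : ∀ i, 0 < lam i → Summable fun w : ℕ => (w : ℝ) * π i w) :
    averageLatency lam π
      = ENNReal.ofReal ((∑ i, lam i * ∑' w : ℕ, (w : ℝ) * π i w) / ∑ i, lam i) := by
  rw [averageLatency, ENNReal.ofReal_div_of_pos hlam, ENNReal.ofReal_sum_of_nonneg fun i _ => h0 i,
    ENNReal.ofReal_sum_of_nonneg]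
  · congr 1
    refine Finset.sum_congr rfl fun i _ => ?_
    rw [ENNReal.ofReal_mul (h0 i)]
    rcases (h0 i).eq_or_lt with h | h
    · simp [← h]
    · rw [ENNReal.ofReal_tsum_of_nonneg (fun w => mul_nonneg (Nat.cast_nonneg _) (hπ i h w))
        (hm i h)]
      simp only [ENNReal.ofReal_mul (Nat.cast_nonneg _), ENNReal.ofReal_natCast]
  · intro i _
    rcases (h0 i).eq_or_lt with h | h
    · simp [← h]
    · exact mul_nonneg (h0 i) (tsum_nonneg fun w => mul_nonneg (Nat.cast_nonneg _) (hπ i h w))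

lemma summable_of_averageLatency_lt_top (hπ : ∀ i, 0 < lam i → ∀ w, 0 ≤ π i w)
    (hfin : averageLatency lam π < ∞) (i : N) (hi : 0 < lam i) :
    Summable fun w : ℕ => (w : ℝ) * π i w := by
  have h1 : ∑ i, ENNReal.ofReal (lam i) ≠ ∞ := ENNReal.sum_ne_top.2 fun _ _ => ENNReal.ofReal_ne_top
  have h2 : ∑ i, ENNReal.ofReal (lam i) * ∑' w : ℕ, (w : ℝ≥0∞) * ENNReal.ofReal (π i w) ≠ ∞ :=
    fun h => hfin.ne (by rw [averageLatency, h, ENNReal.top_div_of_ne_top h1])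
  have h3 : ∑' w : ℕ, (w : ℝ≥0∞) * ENNReal.ofReal (π i w) ≠ ∞ := fun h =>
    ENNReal.sum_ne_top.1 h2 i (Finset.mem_univ i)
      (by rw [h, ENNReal.mul_top (ENNReal.ofReal_pos.2 hi).ne'])
  refine (ENNReal.summable_toReal h3).congr fun w => ?_
  rw [ENNReal.toReal_mul, ENNReal.toReal_natCast, ENNReal.toReal_ofReal (hπ i hi w)]

lemma reductionFormula_eq (h0 : ∀ i, 0 ≤ lam i) (hπ : ∀ i, 0 < lam i → ∀ w, 0 ≤ π i w)
    (hs : ∀ i, 0 < lam i → Summable (π i)) (W : N → ℕ) :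
    reductionFormula lam π W
      = (∑ i, lam i * ∑' w : ℕ, ((min w (W i) : ℕ) : ℝ) * π i w) / ∑ i, lam i := by
  rw [reductionFormula]
  congr 1
  refine Finset.sum_congr rfl fun i _ => ?_
  rcases (h0 i).eq_or_lt with h | h
  · simp [← h]
  · rw [tsum_min_mul (hπ i h) (hs i h)]

lemma tendsto_truncatedLatency_sub (h0 : ∀ i, 0 ≤ lam i) (hπ : ∀ i, 0 < lam i → ∀ w, 0 ≤ π i w)
    (hs : ∀ i, 0 < lam i → Summable (π i)) (W : N → ℕ) :
    Tendsto (fun K => truncatedLatency lam π K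
        - truncatedLatency lam (fun i => shiftDown (π i) (W i)) K) atTop
      (𝓝 (reductionFormula lam π W)) := by
  rw [reductionFormula_eq h0 hπ hs]
  simp only [truncatedLatency, ← sub_div, ← Finset.sum_sub_distrib, ← mul_sub]
  refine (tendsto_finsetSum _ fun i _ => ?_).div_const _
  rcases (h0 i).eq_or_lt with h | h
  · simp [← h]
  · exact (tendsto_tsum_min_sub (hπ i h) (hs i h) (W i)).const_mul _

lemma averageLatency_shiftDown (h0 : ∀ i, 0 ≤ lam i) (hlam : 0 < ∑ i, lam i)
    (hπ : ∀ i, 0 < lam i → ∀ w, 0 ≤ π i w) (hs : ∀ i, 0 < lam i → Summable (π i))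
    (hfin : averageLatency lam π < ∞) (W : N → ℕ) :
    averageLatency lam (fun i => shiftDown (π i) (W i)) < ∞ ∧
      (averageLatency lam π).toReal
        - (averageLatency lam (fun i => shiftDown (π i) (W i))).toReal
          = reductionFormula lam π W := by
  have hm := summable_of_averageLatency_lt_top hπ hfin
  have hπ' : ∀ i, 0 < lam i → ∀ w, 0 ≤ shiftDown (π i) (W i) w :=
    fun i hi => shiftDown_nonneg (hπ i hi) _
  have hnn : ∀ q : N → ℕ → ℝ, (∀ i, 0 < lam i → ∀ w, 0 ≤ q i w) →
      0 ≤ (∑ i, lam i * ∑' w : ℕ, (w : ℝ) * q i w) / ∑ i, lam i := fun q hq => by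
    refine div_nonneg (Finset.sum_nonneg fun i _ => ?_) hlam.le
    rcases (h0 i).eq_or_lt with h | h
    · simp [← h]
    · exact mul_nonneg (h0 i) (tsum_nonneg fun w => mul_nonneg (Nat.cast_nonneg _) (hq i h w))
  rw [averageLatency_eq_ofReal h0 hlam hπ hm, averageLatency_eq_ofReal h0 hlam hπ'
    fun i hi => summable_mul_shiftDown (hπ i hi) (hm i hi) _]
  refine ⟨ENNReal.ofReal_lt_top, ?_⟩
  rw [ENNReal.toReal_ofReal (hnn _ hπ), ENNReal.toReal_ofReal (hnn _ hπ'), ← sub_div,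
    ← Finset.sum_sub_distrib, reductionFormula_eq h0 hπ hs]
  congr 1
  refine Finset.sum_congr rfl fun i _ => ?_
  rcases (h0 i).eq_or_lt with h | h
  · simp [← h]
  · rw [← mul_sub, tsum_mul_sub_shiftDown (hπ i h) (hm i h)]

lemma tendsto_reductionFormula (h0 : ∀ i, 0 ≤ lam i) (hlam : 0 < ∑ i, lam i)
    (hπ : ∀ i, 0 < lam i → ∀ w, 0 ≤ π i w) (hs : ∀ i, 0 < lam i → Summable (π i))
    (hfin : averageLatency lam π < ∞) :
    Tendsto (reductionFormula lam π) atTop (𝓝 (averageLatency lam π).toReal) := by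
  have hm := summable_of_averageLatency_lt_top hπ hfin
  rw [averageLatency_eq_ofReal h0 hlam hπ hm, ENNReal.toReal_ofReal]
  · rw [funext (reductionFormula_eq h0 hπ hs)]
    refine (tendsto_finsetSum _ fun i _ => ?_).div_const _
    rcases (h0 i).eq_or_lt with h | h
    · simp [← h]
    · refine ((tendsto_tsum_min_mul (hπ i h) (hm i h)).comp ?_).const_mul _
      -- In the product order, `W` eventually dominates the constant window `n`.
      exact tendsto_atTop.2 fun n =>
        (eventually_ge_atTop fun _ : N => n).mono fun W hW => hW i
  · refine div_nonneg (Finset.sum_nonneg fun i _ => ?_) hlam.le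
    rcases (h0 i).eq_or_lt with h | h
    · simp [← h]
    · exact mul_nonneg (h0 i) (tsum_nonneg fun w => mul_nonneg (Nat.cast_nonneg _) (hπ i h w))

end Average

/-! ### Transfer of the steady-state probabilities -/

section SteadyState

/-- Finitely many initial terms do not change a limiting fraction of a diverging total. -/
lemma tendsto_add_div_add {f g : ℕ → ℝ} {p : ℝ} (hg : Tendsto g atTop atTop)
    (h : Tendsto (fun T => f T / g T) atTop (𝓝 p)) (a b : ℝ) :
    Tendsto (fun T => (a + f T) / (b + g T)) atTop (𝓝 p) := by
  have h1 : Tendsto (fun T => (a / g T + f T / g T) / (b / g T + 1)) atTop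
      (𝓝 ((0 + p) / (0 + 1))) :=
    ((hg.const_div_atTop a).add h).div ((hg.const_div_atTop b).add tendsto_const_nhds) (by simp)
  rw [zero_add, zero_add, div_one] at h1
  refine h1.congr' ?_
  filter_upwards [hg.eventually_gt_atTop 0] with T hT
  rw [← add_div, div_add_one hT.ne', div_div_div_cancel_right₀ hT.ne']

variable {N M Ω : Type*} [MeasurableSpace Ω] {μ : Measure Ω}
  {lam : N → ℝ} {A : Ω → ℕ → N → ℝ} {E : Ω → ℕ → Environment N M}

lemma IsInput.mean_nonneg (h : IsInput μ lam A E) (i : N) : 0 ≤ lam i := by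
  rw [← h.mean_arrivals 0 i]
  exact integral_nonneg fun ω => h.arrivals_nonneg ω 0 i

/-- By the strong law the total grows like `lam i * T`. Divergence makes the first `W i` slots
negligible in the long-run fractions. -/
lemma IsInput.tendsto_sum_arrivals [IsProbabilityMeasure μ] (h : IsInput μ lam A E)
    {i : N} (hi : 0 < lam i) :
    ∀ᵐ ω ∂μ, Tendsto (fun T : ℕ => ∑ s ∈ Finset.range T, A ω s i) atTop atTop := by
  obtain ⟨C, hC⟩ := h.arrivals_bounded
  have hint : Integrable (fun ω => A ω 0 i) μ :=
    Integrable.of_bound (h.measurable_arrival (0, i)).aestronglyMeasurable C <|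
      Eventually.of_forall fun ω => by
        rw [Real.norm_of_nonneg (h.arrivals_nonneg ω 0 i)]
        exact hC ω 0 i
  have hslln := strong_law_ae_real (fun s ω => A ω s i) hint
    (fun s t hst => h.arrivals_indep.indepFun (i := (s, i)) (j := (t, i)) (by simpa using hst))
    (fun s => h.arrivals_identDistrib s i)
  rw [h.mean_arrivals] at hslln
  filter_upwards [hslln] with ω hω
  refine (hω.pos_mul_atTop hi tendsto_natCast_atTop_atTop).congr' ?_
  filter_upwards [eventually_gt_atTop 0] with T hT
  exact div_mul_cancel₀ _ (Nat.cast_ne_zero.2 hT.ne')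

variable [Fintype N] [IsProbabilityMeasure μ] {net : FogNetwork N M}
  {rule : OffloadingRule N M} {π : N → ℕ → ℝ}

lemma IsSteadyLatency.nonneg {x : Ω → Backlog N M} (hA : ∀ ω t i, 0 ≤ A ω t i)
    (h : IsSteadyLatency net rule μ lam 0 A E x π) (i : N) (hi : 0 < lam i) (w : ℕ) :
    0 ≤ π i w := by
  obtain ⟨ω, hω⟩ := (h i hi).2.exists
  exact ge_of_tendsto' (hω w) fun T => div_nonneg
    (Finset.sum_nonneg fun s _ => workloadOfLatency_nonneg net rule _ _ _ (hA ω) i s w)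
    (Finset.sum_nonneg fun s _ => hA ω s i)

/-- Prediction shifts the steady-state latency down by the length of the prediction window. -/
lemma IsSteadyLatency.shiftDown (hinput : IsInput μ lam A E) {W : N → ℕ} {x : Ω → Backlog N M}
    (h : IsSteadyLatency net rule μ lam 0 (fun ω => advancedArrivals W (A ω)) E
      (fun ω => advancedBacklog W (A ω) (x ω)) π) :
    IsSteadyLatency net rule μ lam W A E x (fun i => shiftDown (π i) (W i)) := by
  intro i hi
  obtain ⟨hsum, hlim⟩ := h i hi
  refine ⟨hasSum_shiftDown_iff.2 hsum, ?_⟩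
  filter_upwards [hlim, (hinput.advance W).tendsto_sum_arrivals hi] with ω hω hdiv w
  have hA := hinput.arrivals_nonneg ω
  -- The first `W i` slots, which are initial backlog in the coupled system, are split off from
  -- numerator and denominator.
  rw [← tendsto_add_atTop_iff_nat (W i)]
  simp only [add_comm _ (W i), Finset.sum_range_add]
  refine tendsto_add_div_add (g := fun T => ∑ s ∈ Finset.range T, A ω (W i + s) i) ?_ ?_ _ _
  · refine hdiv.congr fun T => Finset.sum_congr rfl fun s _ => ?_
    rw [advancedArrivals, add_comm]
  · by_cases hw : w = 0
    · subst hw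
      simp only [_root_.shiftDown, if_true]
      refine (tendsto_finsetSum (Finset.range (W i + 1)) fun v _ => hω v).congr fun T => ?_
      rw [← Finset.sum_div, Finset.sum_comm]
      simp only [add_comm (W i) _, workloadOfLatency_add_zero net rule W _ _ _ hA]
      rfl
    · simp only [_root_.shiftDown, if_neg hw]
      refine (hω (w + W i)).congr fun T => ?_
      simp only [add_comm (W i) _, workloadOfLatency_add_of_pos net rule W _ _ _ hA _ _ hw]
      rfl

end SteadyState

theorem theorem2 {N M Ω : Type*} [Fintype N] [Fintype M] [MeasurableSpace Ω]
    (μ : Measure Ω) [IsProbabilityMeasure μ]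
    (net : FogNetwork N M) (rule : OffloadingRule N M) (hrule : rule.IsPORA net)
    (lam : N → ℝ) (A : Ω → ℕ → N → ℝ) (E : Ω → ℕ → Environment N M)
    (hinput : IsInput μ lam A E) (hlam : 0 < ∑ i, lam i)
    (π : N → ℕ → ℝ)
    (hπ : SteadyLatencyFromStatistics net rule μ lam 0 A E π) :
    ∃ ρ : (N → ℕ) → N → ℕ → ℝ,
      (∀ W, SteadyLatencyFromStatistics net rule μ lam W A E (ρ W)) ∧
      (∀ W, Tendsto (fun K => truncatedLatency lam π K - truncatedLatency lam (ρ W) K)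
        atTop (𝓝 (reductionFormula lam π W))) ∧
      (averageLatency lam π < ∞ →
        (∀ W, averageLatency lam (ρ W) < ∞ ∧
          (averageLatency lam π).toReal - (averageLatency lam (ρ W)).toReal
            = reductionFormula lam π W) ∧
        Tendsto
          (fun W : N → ℕ =>
            (averageLatency lam π).toReal - (averageLatency lam (ρ W)).toReal)
          atTop (𝓝 (averageLatency lam π).toReal)) := by
  have h0 := hinput.mean_nonneg
  -- The start from empty queues is one admissible instance; nonnegativity and summability of `π`
  -- are read off from it.
  have hsteady : IsSteadyLatency net rule μ lam 0 A E (fun _ _ _ => 0) π :=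
    hπ A E _ hinput (.refl hinput.measurable_arrivals.aemeasurable)
      (.refl hinput.measurable_environment.aemeasurable) measurable_const (fun _ _ _ => le_rfl)
      (indepFun_const_left _ _)
  have hnn := hsteady.nonneg hinput.arrivals_nonneg
  have hs : ∀ i, 0 < lam i → Summable (π i) := fun i hi => (hsteady i hi).1.summable
  refine ⟨fun W i => shiftDown (π i) (W i), fun W A' E' x hin hA hE hx hx0 hind => ?_,
    tendsto_truncatedLatency_sub h0 hnn hs, fun hfin => ?_⟩
  -- The hypothesis is used at the advanced arrivals and enlarged backlog, which is why it must
  -- cover all realizations and random initial backlogs.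
  · exact IsSteadyLatency.shiftDown hin <| hπ _ E' _ (hin.advance W)
      ((hin.identDistrib_advance W).trans hA) hE (hin.measurable_advancedBacklog W hx)
      (fun ω => advancedBacklog_nonneg (hin.arrivals_nonneg ω) (hx0 ω))
      (hin.indepFun_advancedBacklog W hx hind)
  · have hav := averageLatency_shiftDown h0 hlam hnn hs hfin
    exact ⟨hav, (tendsto_reductionFormula h0 hlam hnn hs hfin).congr fun W => (hav W).2.symm⟩
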